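/- Let $n\ge 0$ be an integer and let $0<q\le 1$, $t\ge 0$ be real. Let $\mathbf T_n(q,t)\subset\mathbb R^n$ be the Tutte polytope, i.e. the set of all $(x_1,\dots,x_n)$ which, with $x_0=1$, satisfy $x_n\ge 1-q$ and $$q\,x_i\;\le\; q(1+t)\,x_{i-1}-t(1-q)(1-x_{j-1})\qquad\text{for all } 1\le j\le i\le n.$$ For a finite graph $G$ with node set $V$ let $$\mathrm T_G(x,y)=\sum_{H\subseteq G}(x-1)^{k(H)-k(G)}(y-1)^{e(H)-|V|+k(H)}$$ be its Tutte polynomial, where the sum is over all spanning subgraphs $H$ of $G$, and $k$ and $e$ denote the numbers of connected components and of edges. Then $$\mathrm{vol}\,\mathbf T_n(q,t)=\frac{t^n\,\mathrm T_{K_{n+1}}(1+q/t,\,1+t)}{n!},$$ where $K_{n+1}$ is the complete graph on $n+1$ nodes and, for $t=0$, the right-hand side is understood as its limit as $t\to0+$ with $q$ fixed. -/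

import Mathlib

open MeasureTheory Filter Topology

noncomputable section

open Classical in
/-- The Tutte polynomial of a finite graph `G`, as a polynomial in the two variables
`x = X 0` and `y = X 1`, namely
`∑ (x - 1) ^ (k(H) - k(G)) * (y - 1) ^ (e(H) - |V| + k(H))` over all spanning subgraphs `H` of `G`,
where `k` is the number of connected components and `e` the number of edges.
Both natural-number subtractions are exact, as `k(G) ≤ k(H)` and `|V| ≤ e(H) + k(H)`. -/
def tuttePolynomial {V : Type*} [Fintype V] (G : SimpleGraph V) : MvPolynomial (Fin 2) ℤ :=
  ∑ H : SimpleGraph V with H ≤ G,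
    (MvPolynomial.X 0 - 1) ^ (Nat.card H.ConnectedComponent - Nat.card G.ConnectedComponent) *
    (MvPolynomial.X 1 - 1) ^
      (H.edgeSet.ncard + Nat.card H.ConnectedComponent - Fintype.card V)

/-- The value `T_G(x, y)` of the Tutte polynomial at real numbers. -/
def tutteEval {V : Type*} [Fintype V] (G : SimpleGraph V) (x y : ℝ) : ℝ :=
  MvPolynomial.aeval ![x, y] (tuttePolynomial G)

/-- `withZeroth (x₁, …, xₙ) = (x₀, x₁, …, xₙ)` with `x₀ = 1`. -/
def withZeroth {n : ℕ} (x : Fin n → ℝ) : Fin (n + 1) → ℝ := Fin.cons 1 x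

/-- The Tutte polytope: `xₙ ≥ 1 - q` and
`q xᵢ ≤ q (1 + t) xᵢ₋₁ - t (1 - q) (1 - xⱼ₋₁)` for `1 ≤ j ≤ i ≤ n`, with `x₀ = 1`.
The indices `i j : Fin n` of the code are `i - 1` and `j - 1` of the formula. -/
def tuttePolytope (n : ℕ) (q t : ℝ) : Set (Fin n → ℝ) :=
  {x | 1 - q ≤ withZeroth x (Fin.last n) ∧
    ∀ i j : Fin n, j ≤ i →
      q * withZeroth x i.succ ≤
        q * (1 + t) * withZeroth x i.castSucc - t * (1 - q) * (1 - withZeroth x j.castSucc)}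

end

/-! Translating by `1 - q` makes the constraints homogeneous: `yᵢ ≤ (1 + t) yᵢ₋₁ + c yⱼ₋₁` with `c =
t (1 - q) / q`, `y₀ = q` and `y ≥ 0`. As `c ≥ 0`, the last entry `a` and the minimum `m` of the
entries so far decide which continuations are allowed, so slicing gives a recursion for their volume
in `a` and `m`.

Let `F(z) = ∑ (1 + t) ^ (n choose 2) zⁿ / n!`, which satisfies `F'(z) = F((1 + t) z)`. The recursion
is solved by the coefficient of `zⁿ` in `F ^ (q - 1) (m z / q) * F((1 + t) (a + (1 - q) m / q) z)`
(`continuationVolume_succ`, `volume_continuationSet`). At `a = m = q` this is the coefficient of `F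
^ (q - 1) F' = (F ^ q)' / q`. Finally `F ^ q` is the generating function of graphs weighted by `q ^
k t ^ e` (`graphEGF_natCast`, extended to real `q` by `derivative_graphEGF_mul`), and on `n + 1`
nodes this weight sum is the Tutte polynomial up to powers of `q` and `t`
(`pow_mul_tutteEval_completeGraph`). -/

namespace SimpleGraph

/-! ### Graphs, components and colourings -/

/-- The graph joining distinct vertices of the same colour. -/
def monochromatic {V α : Type*} (f : V → α) : SimpleGraph V where
  Adj u v := u ≠ v ∧ f u = f v
  symm := ⟨fun _ _ h => ⟨h.1.symm, h.2.symm⟩⟩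
  loopless := ⟨fun _ h => h.1 rfl⟩

lemma le_monochromatic_iff {V α : Type*} {H : SimpleGraph V} {f : V → α} :
    H ≤ monochromatic f ↔ ∀ u v, H.Adj u v → f u = f v :=
  ⟨fun h _ _ huv => (h huv).2, fun h _ _ huv => ⟨huv.ne, h _ _ huv⟩⟩

/-- Colourings constant along edges are colourings of the components. -/
def componentColouringEquiv {V : Type*} (H : SimpleGraph V) (α : Type*) :
    (H.ConnectedComponent → α) ≃ {f : V → α // H ≤ monochromatic f} where
  toFun g := ⟨fun v => g (H.connectedComponentMk v), le_monochromatic_iff.2 fun _ _ h => by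
    rw [ConnectedComponent.eq.2 h.reachable]⟩
  invFun f := ConnectedComponent.lift f.1 fun u v p _ => by
    have h := le_monochromatic_iff.1 f.2
    induction p with
    | nil => rfl
    | cons hadj p ih =>
      rename_i hp
      exact (h _ _ hadj).trans (ih ((Walk.cons_isPath_iff _ _).1 hp).1)
  left_inv g := by
    funext c
    induction c using ConnectedComponent.ind
    rfl
  right_inv f := rfl

open Classical in
lemma card_pow_card_connectedComponent {V α : Type*} [Fintype V] [DecidableEq V] [Fintype α]
    (H : SimpleGraph V) :
    Fintype.card α ^ Nat.card H.ConnectedComponent =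
      ∑ f : V → α, if H ≤ monochromatic f then 1 else 0 := by
  rw [Finset.sum_boole, ← Nat.card_eq_fintype_card, ← Nat.card_fun,
    Nat.card_congr (componentColouringEquiv H α), Nat.card_eq_fintype_card, Fintype.card_subtype]
  rfl

open Classical in
lemma sum_subgraph_pow_ncard_edgeSet {V : Type*} [Fintype V] [DecidableEq V] {R : Type*} [CommSemiring R]
    (G : SimpleGraph V) (t : R) :
    ∑ H : SimpleGraph V with H ≤ G, t ^ H.edgeSet.ncard = (1 + t) ^ G.edgeSet.ncard := by
  rw [Set.ncard_eq_toFinset_card', add_comm, ← Finset.sum_pow_mul_eq_add_pow]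
  refine Finset.sum_bij' (fun H _ => H.edgeSet.toFinset)
    (fun S _ => fromEdgeSet (S : Set (Sym2 V))) ?_ ?_ ?_ ?_ ?_
  · intro H hH
    simpa using hH
  · intro S hS
    have hS' : (S : Set (Sym2 V)) ⊆ G.edgeSet := by simpa [← Finset.coe_subset] using hS
    have := fromEdgeSet_mono hS'
    simpa using this
  · intro H _
    simp
  · intro S hS
    have hS' : (S : Set (Sym2 V)) ⊆ G.edgeSet := by simpa [← Finset.coe_subset] using hS
    ext e
    simp only [edgeSet_fromEdgeSet, Set.mem_toFinset, Set.mem_sdiff, Finset.mem_coe]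
    exact ⟨fun h => h.1, fun h => ⟨h, G.not_isDiag_of_mem_edgeSet (hS' h)⟩⟩
  · intro H _
    simp [Set.ncard_eq_toFinset_card']

open Classical in
lemma ncard_edgeSet_monochromatic {V α : Type*} [Fintype V] [Fintype α] [DecidableEq α] (f : V → α) :
    (monochromatic f).edgeSet.ncard =
      ∑ c : α, (Finset.card {v | f v = c}).choose 2 := by
  have h := (monochromatic f).sum_degrees_eq_twice_card_edges
  have hdeg : ∀ v, (monochromatic f).degree v = Finset.card {u | f u = f v} - 1 := by
    intro v
    rw [← card_neighborFinset_eq_degree, ← Finset.card_erase_of_mem (a := v) (by simp)]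
    congr 1
    ext u
    rw [mem_neighborFinset]
    simp [monochromatic, eq_comm]
  have h2 : ∑ v, (monochromatic f).degree v =
      ∑ c : α, 2 * (Finset.card {v | f v = c}).choose 2 := by
    rw [← Finset.sum_fiberwise (g := f)]
    refine Finset.sum_congr rfl fun c _ => ?_
    rw [Finset.sum_congr rfl (g := fun _ => Finset.card {v | f v = c} - 1)
      (fun v hv => by rw [hdeg, (Finset.mem_filter.1 hv).2]), Finset.sum_const, smul_eq_mul,
      Nat.choose_two_right, Nat.mul_div_cancel' (Nat.even_mul_pred_self _).two_dvd]
  rw [h2, ← Finset.mul_sum] at h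
  rw [Set.ncard_eq_toFinset_card']
  exact (Nat.eq_of_mul_eq_mul_left two_pos h).symm

/-- Joining a chosen representative to those of all other components connects the graph. -/
lemma card_le_ncard_edgeSet_add_card_connectedComponent {V : Type*} [Fintype V]
    (H : SimpleGraph V) :
    Fintype.card V ≤ H.edgeSet.ncard + Nat.card H.ConnectedComponent := by
  classical
  rcases isEmpty_or_nonempty V with hV | ⟨⟨v₀⟩⟩
  · simp
  set c₀ := H.connectedComponentMk v₀
  let r : H.ConnectedComponent → V := Quot.out
  have hr : ∀ c, H.connectedComponentMk (r c) = c := Quot.out_eq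
  let S : Set (Sym2 V) := (fun c => s(r c₀, r c)) '' {c | c ≠ c₀}
  have hconn : (H ⊔ fromEdgeSet S).Connected := by
    have key : ∀ v, (H ⊔ fromEdgeSet S).Reachable v (r c₀) := by
      intro v
      have h1 : H.Reachable v (r (H.connectedComponentMk v)) :=
        ConnectedComponent.eq.1 (hr _).symm
      refine (h1.mono le_sup_left).trans ?_
      by_cases hv : H.connectedComponentMk v = c₀
      · rw [hv]
      · refine Adj.reachable (Or.inr ?_)
        rw [fromEdgeSet_adj]
        refine ⟨⟨_, hv, Sym2.eq_swap⟩, fun h => hv ?_⟩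
        rw [← hr (H.connectedComponentMk v), h, hr]
    have : Nonempty V := ⟨v₀⟩
    exact ⟨fun u v => (key u).trans (key v).symm⟩
  have h1 := hconn.card_vert_le_card_edgeSet_add_one
  have h2 : (H ⊔ fromEdgeSet S).edgeSet.ncard ≤ H.edgeSet.ncard + S.ncard := by
    rw [edgeSet_sup, edgeSet_fromEdgeSet]
    exact (Set.ncard_union_le _ _).trans
      (Nat.add_le_add_left (Set.ncard_le_ncard Set.sdiff_subset (Set.toFinite _)) _)
  have h3 : S.ncard + 1 ≤ Nat.card H.ConnectedComponent := by
    have h4 := Set.ncard_add_ncard_compl ({c₀} : Set H.ConnectedComponent)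
    have h5 : S.ncard ≤ ({c₀}ᶜ : Set H.ConnectedComponent).ncard := Set.ncard_image_le (Set.toFinite _)
    rw [Set.ncard_singleton] at h4
    omega
  rw [Nat.card_eq_fintype_card, Nat.card_coe_set_eq] at h1
  omega

end SimpleGraph

/-! ### Exponential generating functions over colour classes -/

namespace PowerSeries
open Nat
/-- The exponential generating function of `w`. -/
noncomputable def egf (w : ℕ → ℝ) : PowerSeries ℝ := mk fun k => w k / k !

lemma derivative_egf (w : ℕ → ℝ) : derivative ℝ (egf w) = egf fun k => w (k + 1) := by
  ext n
  rw [coeff_derivative, egf, egf, coeff_mk, coeff_mk, Nat.factorial_succ]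
  push_cast
  field_simp

lemma derivative_prod {α : Type*} [DecidableEq α] (S : Finset α) (F : α → PowerSeries ℝ) :
    derivative ℝ (∏ c ∈ S, F c) = ∑ a ∈ S, (∏ c ∈ S.erase a, F c) • derivative ℝ (F a) := by
  induction S using Finset.induction_on with
  | empty => simp
  | insert b S hb ih =>
    rw [Finset.prod_insert hb, Derivation.leibniz, ih, Finset.sum_insert hb, Finset.erase_insert hb,
      add_comm, Finset.smul_sum]
    congr 1
    refine Finset.sum_congr rfl fun a ha => ?_
    rw [Finset.erase_insert_of_ne (by rintro rfl; exact hb ha),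
      Finset.prod_insert (fun h => hb (Finset.mem_of_mem_erase h)), smul_smul]

/-- Giving the first element colour `a` shifts the weight sequence `w a` by one, which
differentiates the `a`-th factor; summing over `a` is the Leibniz rule. -/
lemma sum_prod_card_fiber {α : Type*} [Fintype α] [DecidableEq α] (n : ℕ) (w : α → ℕ → ℝ) :
    ∑ f : Fin n → α, ∏ c, w c (Finset.card {i | f i = c}) =
      n ! * coeff n (∏ c, egf (w c)) := by
  induction n generalizing w with
  | zero => simp [egf, map_prod, coeff_zero_eq_constantCoeff_apply]
  | succ n ih =>
    have h1 := coeff_derivative (∏ c, egf (w c)) n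
    rw [Nat.factorial_succ]
    push_cast
    rw [mul_comm (n + 1 : ℝ), mul_assoc, mul_comm (n + 1 : ℝ), ← h1, derivative_prod,
      map_sum, Finset.mul_sum, ← (Fin.consEquiv fun _ : Fin (n + 1) => α).sum_comp,
      Fintype.sum_prod_type]
    refine Finset.sum_congr rfl fun a _ => ?_
    rw [derivative_egf, smul_eq_mul]
    have h2 := ih (Function.update w a fun k => w a (k + 1))
    have h3 : ∏ c, egf (Function.update w a (fun k => w a (k + 1)) c) =
        (∏ c ∈ Finset.univ.erase a, egf (w c)) * egf fun k => w a (k + 1) := by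
      rw [← Finset.prod_erase_mul _ _ (Finset.mem_univ a), Function.update_self]
      congr 1
      exact Finset.prod_congr rfl fun c hc => by
        rw [Function.update_of_ne (Finset.ne_of_mem_erase hc)]
    rw [← h3, ← h2]
    refine Finset.sum_congr rfl fun f _ => Finset.prod_congr rfl fun c _ => ?_
    have h4 : Finset.card {i : Fin (n + 1) | Fin.cons (α := fun _ => α) a f i = c} =
        (if a = c then 1 else 0) + Finset.card {i | f i = c} := by
      rw [Finset.card_filter, Fin.sum_univ_succ, Finset.card_filter]
      simp
    change w c (Finset.card {i : Fin (n + 1) | Fin.cons (α := fun _ => α) a f i = c}) = _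
    rw [h4]
    by_cases hc : a = c
    · subst hc
      simp [add_comm]
    · rw [Function.update_of_ne (Ne.symm hc)]
      simp [hc]

end PowerSeries

/-! ### The graph generating function as a power -/

namespace PowerSeries
open Nat SimpleGraph

/-- The exponential generating function of finite graphs by components and edges. -/
noncomputable def graphEGF (q t : ℝ) : PowerSeries ℝ :=
  egf fun n => ∑ H : SimpleGraph (Fin n), q ^ Nat.card H.ConnectedComponent * t ^ H.edgeSet.ncard

/-- The exponential generating function of all finite graphs by edges. -/
noncomputable def allGraphsEGF (t : ℝ) : PowerSeries ℝ := egf fun n => (1 + t) ^ n.choose 2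

/-- `q ^ k(H)` counts the `q`-colourings constant on the components of `H`. Summing over the
colouring first, `H` is any set of monochromatic edges, so each colour class contributes
independently. -/
lemma graphEGF_natCast (q : ℕ) (t : ℝ) : graphEGF q t = allGraphsEGF t ^ q := by
  classical
  ext n
  have h1 := sum_prod_card_fiber (α := Fin q) n fun _ k => (1 + t) ^ k.choose 2
  rw [graphEGF, egf, coeff_mk, div_eq_iff (by positivity), mul_comm]
  refine Eq.trans ?_ (h1.trans ?_)
  · have h2 : ∀ H : SimpleGraph (Fin n), (q : ℝ) ^ Nat.card H.ConnectedComponent =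
        ∑ f : Fin n → Fin q, if H ≤ monochromatic f then 1 else 0 := fun H => by
      have := card_pow_card_connectedComponent (α := Fin q) H
      rw [Fintype.card_fin] at this
      exact_mod_cast this
    simp_rw [h2, Finset.sum_mul]
    rw [Finset.sum_comm]
    refine Finset.sum_congr rfl fun f _ => ?_
    have h3 := sum_subgraph_pow_ncard_edgeSet (monochromatic f) t
    rw [ncard_edgeSet_monochromatic f, Finset.sum_filter] at h3
    rw [Finset.prod_pow_eq_pow_sum, ← h3]
    simp_rw [ite_mul, one_mul, zero_mul]
  · rw [Finset.prod_const, Finset.card_univ, Fintype.card_fin]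
    rfl

/-- The generating function `graphEGF q t` satisfies the differential equation of
`allGraphsEGF t ^ q`. -/
lemma derivative_graphEGF_mul (q t : ℝ) :
    derivative ℝ (graphEGF q t) * allGraphsEGF t =
      C q * graphEGF q t * derivative ℝ (allGraphsEGF t) := by
  classical
  ext n
  let p : ℕ → Polynomial ℝ := fun n => Polynomial.C (1 / (n ! : ℝ)) *
    ∑ H : SimpleGraph (Fin n),
      Polynomial.X ^ Nat.card H.ConnectedComponent * Polynomial.C (t ^ H.edgeSet.ncard)
  have hp : ∀ (x : ℝ) (k : ℕ), coeff k (graphEGF x t) = (p k).eval x := by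
    intro x k
    simp [p, graphEGF, egf, Polynomial.eval_finsetSum, div_eq_inv_mul]
  let l : Polynomial ℝ := ∑ ij ∈ Finset.HasAntidiagonal.antidiagonal n,
    p (ij.1 + 1) * Polynomial.C ((ij.1 + 1 : ℝ) * coeff ij.2 (allGraphsEGF t))
  let r : Polynomial ℝ := Polynomial.X * ∑ ij ∈ Finset.HasAntidiagonal.antidiagonal n,
    p ij.1 * Polynomial.C (coeff ij.2 (derivative ℝ (allGraphsEGF t)))
  have hl : ∀ x, coeff n (derivative ℝ (graphEGF x t) * allGraphsEGF t) = l.eval x := by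
    intro x
    simp [l, Polynomial.eval_finsetSum, coeff_mul, coeff_derivative, hp, mul_assoc]
  have hr : ∀ x, coeff n (C x * graphEGF x t * derivative ℝ (allGraphsEGF t)) = r.eval x := by
    intro x
    rw [mul_assoc, coeff_C_mul, coeff_mul]
    simp [r, Polynomial.eval_finsetSum, hp]
  rw [hl, hr]
  congr 1
  -- Both coefficients are polynomials in `q`, so it suffices to compare them at natural numbers,
  -- where `graphEGF` is a genuine power.
  refine Polynomial.eq_of_infinite_eval_eq l r
    ((Set.infinite_range_of_injective (Nat.cast_injective (R := ℝ))).mono ?_)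
  rintro _ ⟨k, rfl⟩
  rw [Set.mem_ofPred_eq, ← hl, ← hr, graphEGF_natCast, derivative_pow]
  congr 1
  rw [show C (k : ℝ) = (k : PowerSeries ℝ) from map_natCast C k]
  rcases k with _ | k
  · simp
  · rw [Nat.add_sub_cancel, pow_succ (allGraphsEGF t)]
    ring

lemma constantCoeff_allGraphsEGF (t : ℝ) : constantCoeff (allGraphsEGF t) = 1 := by
  simp [allGraphsEGF, egf, ← coeff_zero_eq_constantCoeff_apply]

/-- Formally, this is `allGraphsEGF t ^ (q - 1)`. -/
noncomputable def graphEGFQuotient (q t : ℝ) : PowerSeries ℝ := graphEGF q t * (allGraphsEGF t)⁻¹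

lemma graphEGFQuotient_mul (q t : ℝ) :
    graphEGFQuotient q t * allGraphsEGF t = graphEGF q t := by
  rw [graphEGFQuotient, mul_assoc, PowerSeries.inv_mul_cancel, mul_one]
  rw [constantCoeff_allGraphsEGF]
  exact one_ne_zero

/-- This is `(n + 1 choose 2) = n + (n choose 2)`; it turns integration in the volume recursion into
a rescaling. -/
lemma derivative_allGraphsEGF (t : ℝ) :
    derivative ℝ (allGraphsEGF t) = rescale (1 + t) (allGraphsEGF t) := by
  ext n
  rw [allGraphsEGF, derivative_egf]
  simp only [coeff_rescale, egf, coeff_mk]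
  rw [Nat.choose_succ_succ' n 1, Nat.choose_one_right, pow_add]
  ring

lemma derivative_graphEGF (q t : ℝ) :
    derivative ℝ (graphEGF q t) =
      C q * (graphEGFQuotient q t * rescale (1 + t) (allGraphsEGF t)) := by
  have h0 : constantCoeff (allGraphsEGF t) ≠ 0 := by
    rw [constantCoeff_allGraphsEGF]
    exact one_ne_zero
  rw [← derivative_allGraphsEGF, graphEGFQuotient, (PowerSeries.eq_mul_inv_iff_mul_eq h0).2
    (derivative_graphEGF_mul q t)]
  ring

lemma coeff_graphEGFQuotient_mul {q : ℝ} (hq : q ≠ 0) (t : ℝ) (n : ℕ) :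
    coeff n (graphEGFQuotient q t * rescale (1 + t) (allGraphsEGF t)) =
      (n + 1) * coeff (n + 1) (graphEGF q t) / q := by
  have h := congrArg (coeff n) (derivative_graphEGF q t)
  rw [coeff_derivative, coeff_C_mul] at h
  rw [eq_div_iff hq, mul_comm _ q, ← h, mul_comm]

lemma hasDerivAt_coeff_mul_rescale (G F : PowerSeries ℝ) (n : ℕ) (u : ℝ) :
    HasDerivAt (fun u => coeff (n + 1) (G * rescale u F))
      (coeff n (G * rescale u (derivative ℝ F))) u := by
  simp only [coeff_mul, Finset.Nat.sum_antidiagonal_succ', coeff_rescale, coeff_derivative]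
  simp only [pow_zero, one_mul]
  refine HasDerivAt.const_add _ (HasDerivAt.fun_sum fun ij _ => ?_)
  refine (((hasDerivAt_pow (ij.2 + 1) u).mul_const _).const_mul _).congr_deriv ?_
  push_cast
  ring

end PowerSeries

/-! ### Graph sums and the Tutte polynomial of the complete graph -/

open Nat PowerSeries in
/-- The generating polynomial of the graphs on `n + 1` nodes, divided by `q` and `n!`. -/
lemma coeff_graphEGFQuotient_mul_eq_sum {q : ℝ} (hq : q ≠ 0) (t : ℝ) (n : ℕ) :
    coeff n (graphEGFQuotient q t * rescale (1 + t) (allGraphsEGF t)) =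
      (∑ H : SimpleGraph (Fin (n + 1)),
        q ^ (Nat.card H.ConnectedComponent - 1) * t ^ H.edgeSet.ncard) / n ! := by
  rw [coeff_graphEGFQuotient_mul hq, graphEGF, egf, coeff_mk, Nat.factorial_succ]
  have h : ∀ H : SimpleGraph (Fin (n + 1)), q ^ Nat.card H.ConnectedComponent =
      q * q ^ (Nat.card H.ConnectedComponent - 1) := fun H => by
    have : 0 < Nat.card H.ConnectedComponent := Nat.card_pos
    rw [← _root_.pow_succ', Nat.sub_add_cancel this]
  simp_rw [h, mul_assoc, ← Finset.mul_sum]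
  push_cast
  field_simp

/-- With `x - 1 = q / t` and `y - 1 = t`, the term of `H` is `(q / t) ^ (k - 1) * t ^ (e - (n + 1) +
k)`, and the factor `t ^ n` leaves `q ^ (k - 1) * t ^ e`. -/
lemma pow_mul_tutteEval_completeGraph (n : ℕ) (q : ℝ) {t : ℝ} (ht : t ≠ 0) :
    t ^ n * tutteEval (SimpleGraph.completeGraph (Fin (n + 1))) (1 + q / t) (1 + t) =
      ∑ H : SimpleGraph (Fin (n + 1)),
        q ^ (Nat.card H.ConnectedComponent - 1) * t ^ H.edgeSet.ncard := by
  classical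
  have h1 : Nat.card (SimpleGraph.completeGraph (Fin (n + 1))).ConnectedComponent = 1 := by
    rw [Nat.card_eq_one_iff_unique]
    have := (SimpleGraph.connected_top (V := Fin (n + 1))).preconnected.subsingleton_connectedComponent
    exact ⟨this, inferInstance⟩
  simp only [tutteEval, tuttePolynomial, map_sum, map_mul, map_pow, map_sub, map_one,
    MvPolynomial.aeval_X, h1, Matrix.cons_val_zero, Matrix.cons_val_one, add_sub_cancel_left]
  rw [Finset.filter_true_of_mem (fun H _ => le_top), Finset.mul_sum]
  refine Finset.sum_congr ?_ fun H _ => ?_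
  · ext; simp
  have h2 := H.card_le_ncard_edgeSet_add_card_connectedComponent
  have h3 : 0 < Nat.card H.ConnectedComponent := Nat.card_pos
  rw [Fintype.card_fin] at h2 ⊢
  rw [div_pow, div_mul_eq_mul_div, mul_div_assoc', div_eq_iff (pow_ne_zero _ ht), mul_left_comm,
    ← pow_add, mul_assoc, ← pow_add]
  congr 2
  omega

/-! ### Volume of the set of continuations, by slicing -/

lemma volume_eq_lintegral_cons {n : ℕ} {S : Set (Fin (n + 1) → ℝ)} (hS : MeasurableSet S) :
    volume S = ∫⁻ b : ℝ, volume {y : Fin n → ℝ | (Fin.cons b y : Fin (n + 1) → ℝ) ∈ S} := by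
  have h := (volume_preserving_piFinSuccAbove (fun _ : Fin (n + 1) => ℝ) 0).symm
  rw [← h.measure_preimage hS.nullMeasurableSet, Measure.volume_eq_prod,
    Measure.prod_apply (h.measurable hS)]
  refine lintegral_congr fun b => congrArg _ ?_
  ext y
  simp [MeasurableEquiv.piFinSuccAbove, Fin.insertNthEquiv]

/-- Nonnegative sequences that continue a sequence with last term `a` and minimum `m`, subject to
the constraints of the Tutte polytope. -/
def continuationSet (s c : ℝ) (n : ℕ) (a m : ℝ) : Set (Fin n → ℝ) :=
  {y | (∀ i, 0 ≤ y i) ∧ ∀ i,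
    y i ≤ s * (Fin.cons a y : Fin (n + 1) → ℝ) i.castSucc + c * m ∧
    ∀ j ≤ i, y i ≤ s * (Fin.cons a y : Fin (n + 1) → ℝ) i.castSucc +
      c * (Fin.cons a y : Fin (n + 1) → ℝ) j.castSucc}

lemma measurableSet_continuationSet (s c : ℝ) (n : ℕ) (a m : ℝ) :
    MeasurableSet (continuationSet s c n a m) := by
  have h : ∀ k : Fin (n + 1), Measurable fun y : Fin n → ℝ =>
      (Fin.cons a y : Fin (n + 1) → ℝ) k := by
    intro k
    refine Fin.cases ?_ (fun k => ?_) k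
    · simp
    · simpa using measurable_pi_apply k
  have h' : ∀ k : Fin n, Measurable fun y : Fin n → ℝ => y k := measurable_pi_apply
  simp only [continuationSet, Set.ofPred_and, Set.ofPred_forall]
  exact (MeasurableSet.iInter fun i => measurableSet_le measurable_const (h' i)).inter <|
    MeasurableSet.iInter fun i => (measurableSet_le (h' i)
      (((h _).const_mul s).add_const _)).inter <| MeasurableSet.iInter fun j =>
      MeasurableSet.iInter fun _ => measurableSet_le (h' i)
        (((h _).const_mul s).add ((h _).const_mul c))

/-- The recursion on the state: choosing `b` replaces `(a, m)` by `(b, min m b)`. Since `c ≥ 0` and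
`m ≤ a`, the bounds involving `c * a` follow from those involving `c * m`. -/
lemma cons_mem_continuationSet {s c : ℝ} (hc : 0 ≤ c) {n : ℕ} {a m b : ℝ} (hma : m ≤ a)
    {y : Fin n → ℝ} :
    (Fin.cons b y : Fin (n + 1) → ℝ) ∈ continuationSet s c (n + 1) a m ↔
      b ∈ Set.Icc 0 (s * a + c * m) ∧ y ∈ continuationSet s c n b (min m b) := by
  have hcm := mul_le_mul_of_nonneg_left hma hc
  simp only [continuationSet, Set.mem_ofPred_eq, Fin.forall_fin_succ (n := n), Fin.cons_zero,
    Fin.cons_succ, Fin.castSucc_zero, Fin.zero_le, Fin.succ_le_succ_iff,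
    Fin.castSucc_succ, Set.mem_Icc, mul_min_of_nonneg _ _ hc, Fin.le_zero_iff]
  constructor
  · rintro ⟨⟨hb, hy⟩, ⟨⟨h1, -⟩, h2⟩⟩
    refine ⟨⟨hb, h1⟩, hy, fun i => ⟨?_, fun j hj => (h2 i).2.2 j hj⟩⟩
    rw [← min_add_add_left, le_min_iff]
    refine ⟨(h2 i).1, ?_⟩
    cases n with
    | zero => exact i.elim0
    | succ n => simpa using (h2 i).2.2 0 (Fin.zero_le i)
  · rintro ⟨⟨hb, h1⟩, hy, h2⟩
    have h3 : ∀ i, y i ≤ s * (Fin.cons b y : Fin (n + 1) → ℝ) i.castSucc + c * m := fun i =>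
      (h2 i).1.trans (add_le_add_right (min_le_left _ _) _)
    refine ⟨⟨hb, hy⟩, ⟨⟨h1, fun _ => by linarith, fun j hj => absurd hj (Fin.succ_ne_zero j)⟩,
      fun i => ⟨h3 i, fun _ => by linarith [h3 i], (h2 i).2⟩⟩⟩

open PowerSeries

/-- The volume of `continuationSet`, for `s = 1 + t` and `c = t * (1 - q) / q`. -/
noncomputable def continuationVolume (q t : ℝ) (n : ℕ) (a m : ℝ) : ℝ :=
  coeff n (rescale (m / q) (graphEGFQuotient q t) *
    rescale ((1 + t) * (a + (1 - q) / q * m)) (allGraphsEGF t))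

lemma continuous_continuationVolume (q t : ℝ) (n : ℕ) {f g : ℝ → ℝ} (hf : Continuous f)
    (hg : Continuous g) : Continuous fun b => continuationVolume q t n (f b) (g b) := by
  simp only [continuationVolume, coeff_mul, coeff_rescale]
  fun_prop

/-- On the diagonal both factors are scaled by `b / q`, so the coefficient is homogeneous in `b`. -/
lemma continuationVolume_self {q : ℝ} (hq : q ≠ 0) (t : ℝ) (n : ℕ) (b : ℝ) :
    continuationVolume q t n b b =
      (b / q) ^ n * coeff n (graphEGFQuotient q t * rescale (1 + t) (allGraphsEGF t)) := by
  have h : (1 + t) * (b + (1 - q) / q * b) = (1 + t) * (b / q) := by field_simp; ring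
  rw [continuationVolume, h, ← rescale_rescale, ← map_mul, coeff_rescale]

lemma hasDerivAt_continuationVolume (q t : ℝ) (n : ℕ) (m b : ℝ) :
    HasDerivAt (fun b => coeff (n + 1) (rescale (m / q) (graphEGFQuotient q t) *
      rescale (b + (1 - q) / q * m) (allGraphsEGF t))) (continuationVolume q t n b m) b := by
  have h := (hasDerivAt_coeff_mul_rescale (rescale (m / q) (graphEGFQuotient q t))
    (allGraphsEGF t) n (b + (1 - q) / q * m)).comp b ((hasDerivAt_id b).add_const _)
  rw [derivative_allGraphsEGF, rescale_rescale, mul_one] at h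
  exact h

/-- The integral over the next entry splits at `m`: below it the minimum drops to `b`, above it the
minimum stays `m`. The boundary term of the second integral at `m` is a coefficient of `F ^ q`
scaled by `m / q`, and it cancels the first integral. -/
lemma continuationVolume_succ {q : ℝ} (hq : q ≠ 0) (t : ℝ) (n : ℕ) {a m : ℝ} :
    continuationVolume q t (n + 1) a m =
      (∫ b in 0..m, continuationVolume q t n b b) +
        ∫ b in m..((1 + t) * a + t * (1 - q) / q * m), continuationVolume q t n b m := by
  have hcont : Continuous fun b => continuationVolume q t n b m :=
    continuous_continuationVolume q t n continuous_id continuous_const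
  rw [intervalIntegral.integral_eq_sub_of_hasDerivAt
    (fun b _ => hasDerivAt_continuationVolume q t n m b) (hcont.intervalIntegrable _ _)]
  simp_rw [continuationVolume_self hq]
  have h1 : (1 + t) * a + t * (1 - q) / q * m + (1 - q) / q * m =
      (1 + t) * (a + (1 - q) / q * m) := by field_simp; ring
  have h2 : m + (1 - q) / q * m = m / q := by field_simp; ring
  rw [h1, h2, ← map_mul, coeff_rescale, graphEGFQuotient_mul, coeff_graphEGFQuotient_mul hq]
  simp only [div_pow, intervalIntegral.integral_mul_const, intervalIntegral.integral_div,
    integral_pow, zero_pow n.succ_ne_zero, sub_zero, continuationVolume]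
  have : (n + 1 : ℝ) ≠ 0 := by positivity
  field_simp
  ring

lemma volume_continuationSet {q t : ℝ} (hq0 : 0 < q) (hq1 : q ≤ 1) (ht : 0 ≤ t) (n : ℕ) {a m : ℝ}
    (hm : 0 ≤ m) (hma : m ≤ a) :
    0 ≤ continuationVolume q t n a m ∧
      volume (continuationSet (1 + t) (t * (1 - q) / q) n a m) =
        ENNReal.ofReal (continuationVolume q t n a m) := by
  induction n generalizing a m with
  | zero =>
    have h1 : continuationVolume q t 0 a m = 1 := by
      have h := congrArg (coeff 0) (graphEGFQuotient_mul q t)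
      have h2 : coeff 0 (graphEGF q t) = 1 := by
        have h3 : ∀ H : SimpleGraph (Fin 0), H.edgeSet.ncard = 0 := fun H => by
          rw [Subsingleton.elim H ⊥]
          simp
        simp [graphEGF, egf, h3]
      rw [h2, coeff_mul] at h
      rw [continuationVolume, coeff_mul]
      simpa using h
    have h2 : continuationSet (1 + t) (t * (1 - q) / q) 0 a m = Set.univ := by
      ext y
      simp [continuationSet]
    rw [h1, h2, volume_pi, Measure.pi_of_empty]
    simp
  | succ n ih =>
    set s := 1 + t with hs
    set c := t * (1 - q) / q with hc
    have hc0 : 0 ≤ c := div_nonneg (mul_nonneg ht (sub_nonneg.2 hq1)) hq0.le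
    have ha : 0 ≤ a := hm.trans hma
    -- The splitting point `m` lies within the range of the next entry.
    have hmM : m ≤ s * a + c * m := by
      nlinarith [mul_nonneg ht ha, mul_nonneg hc0 hm]
    have hM := hm.trans hmM
    let φ : ℝ → ℝ := fun b => continuationVolume q t n b (min m b)
    have hφ : Continuous φ := continuous_continuationVolume q t n continuous_id
      (continuous_const.min continuous_id)
    have hφ0 : ∀ b ∈ Set.Icc 0 (s * a + c * m), 0 ≤ φ b := fun b hb =>
      (ih (le_min hm hb.1) (min_le_right _ _)).1
    have hint : ∫ b in 0..(s * a + c * m), φ b = continuationVolume q t (n + 1) a m := by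
      rw [continuationVolume_succ hq0.ne', ← intervalIntegral.integral_add_adjacent_intervals
        (hφ.intervalIntegrable 0 m) (hφ.intervalIntegrable m _)]
      congr 1
      · refine intervalIntegral.integral_congr fun b hb => ?_
        rw [Set.uIcc_of_le hm] at hb
        simp only [φ, min_eq_right hb.2]
      · refine intervalIntegral.integral_congr fun b hb => ?_
        rw [Set.uIcc_of_le hmM] at hb
        simp only [φ, min_eq_left hb.1]
    refine ⟨hint ▸ intervalIntegral.integral_nonneg hM hφ0, ?_⟩
    rw [volume_eq_lintegral_cons (measurableSet_continuationSet _ _ _ _ _), ← hint,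
      intervalIntegral.integral_of_le hM, ← integral_Icc_eq_integral_Ioc,
      ofReal_integral_eq_lintegral_ofReal (hφ.integrableOn_Icc)
        ((ae_restrict_iff' measurableSet_Icc).2 (Eventually.of_forall hφ0)),
      ← lintegral_indicator measurableSet_Icc]
    refine lintegral_congr fun b => ?_
    simp_rw [cons_mem_continuationSet hc0 hma]
    by_cases hb : b ∈ Set.Icc 0 (s * a + c * m)
    · rw [Set.indicator_of_mem hb, ← (ih (le_min hm hb.1) (min_le_right _ _)).2]
      congr 1
      ext y
      simp only [hb, true_and, Set.mem_ofPred_eq]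
    · rw [Set.indicator_of_notMem hb]
      simp [hb]

/-! ### Translation of the polytope and conclusion -/

lemma preimage_sub_continuationSet (n : ℕ) {q t : ℝ} (hq0 : 0 < q) (hq1 : q ≤ 1) (ht : 0 ≤ t) :
    (fun x : Fin n → ℝ => x - fun _ => 1 - q) ⁻¹'
      continuationSet (1 + t) (t * (1 - q) / q) n q q = tuttePolytope n q t := by
  ext x
  obtain ⟨y, rfl⟩ : ∃ y : Fin n → ℝ, x = y + fun _ => 1 - q := ⟨x - fun _ => 1 - q, by simp⟩
  let Y : Fin (n + 1) → ℝ := Fin.cons q y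
  have hX : ∀ k, withZeroth (y + fun _ => 1 - q) k = Y k + (1 - q) := by
    intro k
    refine Fin.cases ?_ (fun k => ?_) k <;> simp [withZeroth, Y]
  have hY : ∀ i, Y i.succ = y i := fun i => rfl
  have hiff : ∀ i j : Fin n, (q * withZeroth (y + fun _ => 1 - q) i.succ ≤
        q * (1 + t) * withZeroth (y + fun _ => 1 - q) i.castSucc -
          t * (1 - q) * (1 - withZeroth (y + fun _ => 1 - q) j.castSucc)) ↔
      y i ≤ (1 + t) * Y i.castSucc + t * (1 - q) / q * Y j.castSucc := by
    intro i j
    rw [hX, hX, hX, hY, ← mul_le_mul_iff_right₀ hq0 (b := y i)]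
    have : q * ((1 + t) * Y i.castSucc + t * (1 - q) / q * Y j.castSucc) =
        q * (1 + t) * Y i.castSucc + t * (1 - q) * Y j.castSucc := by field_simp
    rw [this, ← sub_nonneg, ← sub_nonneg (b := q * y i)]
    refine Eq.to_iff (congrArg _ ?_)
    ring
  simp only [Set.mem_preimage, add_sub_cancel_right, tuttePolytope, Set.mem_ofPred_eq, hiff,
    continuationSet]
  rw [hX]
  change ((∀ i, 0 ≤ y i) ∧ ∀ i, y i ≤ (1 + t) * Y i.castSucc + t * (1 - q) / q * q ∧
    ∀ j ≤ i, y i ≤ (1 + t) * Y i.castSucc + t * (1 - q) / q * Y j.castSucc) ↔ _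
  constructor
  · rintro ⟨h0, h⟩
    refine ⟨?_, fun i => (h i).2⟩
    have : 0 ≤ Y (Fin.last n) := by
      refine Fin.cases ?_ (fun k => ?_) (Fin.last n)
      · exact hq0.le
      · exact h0 k
    linarith
  · rintro ⟨hlast, h⟩
    have hc0 : 0 ≤ t * (1 - q) / q := div_nonneg (mul_nonneg ht (sub_nonneg.2 hq1)) hq0.le
    have hpos : ∀ k, 0 ≤ Y k := by
      intro k
      -- Only the last entry is bounded below directly; the constraint with `j = i` bounds each
      -- entry by a positive multiple of its predecessor, so nonnegativity propagates backwards.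
      induction k using Fin.reverseInduction with
      | last => linarith
      | cast i ih =>
        have h1 := h i i le_rfl
        rw [← hY, ← add_mul] at h1
        exact nonneg_of_mul_nonneg_right (ih.trans h1) (by positivity)
    refine ⟨fun i => hpos i.succ, fun i => ⟨?_, h i⟩⟩
    -- The starting minimum is `q = Y 0`, so the bound by the minimum is the constraint whose `j` is
    -- the first index.
    cases n with
    | zero => exact i.elim0
    | succ n => exact h i 0 (Fin.zero_le i)

lemma volume_tuttePolytope (n : ℕ) {q t : ℝ} (hq0 : 0 < q) (hq1 : q ≤ 1) (ht : 0 ≤ t) :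
    volume (tuttePolytope n q t) = ENNReal.ofReal ((∑ H : SimpleGraph (Fin (n + 1)),
      q ^ (Nat.card H.ConnectedComponent - 1) * t ^ H.edgeSet.ncard) / n.factorial) := by
  rw [← preimage_sub_continuationSet n hq0 hq1 ht,
    (measurePreserving_sub_right volume (fun _ : Fin n => 1 - q)).measure_preimage
      (measurableSet_continuationSet _ _ _ _ _).nullMeasurableSet,
    (volume_continuationSet hq0 hq1 ht n hq0.le le_rfl).2, continuationVolume_self hq0.ne',
    div_self hq0.ne', one_pow, one_mul, coeff_graphEGFQuotient_mul_eq_sum hq0.ne']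

theorem theorem1p3 (n : ℕ) (q t : ℝ) (hq0 : 0 < q) (hq1 : q ≤ 1) (ht : 0 ≤ t) :
    (0 < t →
      volume (tuttePolytope n q t) =
        ENNReal.ofReal
          (t ^ n * tutteEval (SimpleGraph.completeGraph (Fin (n + 1))) (1 + q / t) (1 + t) / n.factorial)) ∧
    (t = 0 →
      Tendsto
        (fun s : ℝ => ENNReal.ofReal
          (s ^ n * tutteEval (SimpleGraph.completeGraph (Fin (n + 1))) (1 + q / s) (1 + s) / n.factorial))
        (𝓝[>] 0) (𝓝 (volume (tuttePolytope n q t)))) := by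
  refine ⟨fun h => ?_, ?_⟩
  · rw [volume_tuttePolytope n hq0 hq1 ht, pow_mul_tutteEval_completeGraph n q h.ne']
  · rintro rfl
    rw [volume_tuttePolytope n hq0 hq1 le_rfl]
    -- The right-hand side agrees for `s > 0` with a polynomial in `s`, whose value at `0` is the
    -- volume at `t = 0`.
    let f : ℝ → ℝ := fun s => (∑ H : SimpleGraph (Fin (n + 1)),
      q ^ (Nat.card H.ConnectedComponent - 1) * s ^ H.edgeSet.ncard) / n.factorial
    have hf : Continuous f := by fun_prop
    refine Tendsto.congr' ?_ (ENNReal.tendsto_ofReal (hf.tendsto 0 |>.mono_left nhdsWithin_le_nhds))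
    filter_upwards [self_mem_nhdsWithin] with s hs
    rw [pow_mul_tutteEval_completeGraph n q (ne_of_gt hs)]
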